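/- **Setting.** Let $d\ge 1$, let $\Omega=\prod_{i=1}^d(a_i,b_i)\subset\mathbb R^d$ be a bounded box, let $\varepsilon>0$, and let $(\cdot,\cdot)$ and $\|\cdot\|$ be the inner product and norm of $L^2(\Omega)$. Let $0=t_0<t_1<\dots<t_N=T$, $\tau_k=t_k-t_{k-1}$ for $1\le k\le N$, and $r_k=\tau_k/\tau_{k-1}$ for $2\le k\le N$. For a sequence $(v^n)_{n=0}^N$ put $$D_3v^n=\sum_{k=1}^{n}b^{(n)}_{n-k}\,(v^k-v^{k-1}),\qquad 1\le n\le N,$$ where $b_0^{(1)}=\dfrac1{\tau_1}$, $\;b_0^{(2)}=\dfrac{1+2r_2}{\tau_2(1+r_2)}$, $\;b_1^{(2)}=-\dfrac{r_2^2}{\tau_2(1+r_2)}$, and for $n\ge 3$, with $r=r_n$, $s=r_{n-1}$ and $Q=\tau_n(1+r)(1+s)(1+s+rs)$, $$b_0^{(n)}=\frac{(1+s)\left[1+2r+s(1+4r+3r^2)\right]}{Q},\quad b_1^{(n)}=-\frac{r^2\left[(1+2s+rs)^2-s(1+s)\right]}{Q},\quad b_2^{(n)}=\frac{r^2s^3(1+r)^2}{Q},\quad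 b_j^{(n)}=0\ (j\ge3).$$ The variable-step BDF3 scheme for the Allen–Cahn equation with periodic boundary conditions on $\Omega$ is $$D_3u^n-\varepsilon^2\Delta u^n+(u^n)^3-u^n=0,\qquad 1\le n\le N,$$ for $u^0,\dots,u^N\in V:=H^1_{\rm per}(\Omega)\cap L^4(\Omega)$, understood weakly: for all $\varphi\in V$, $$(D_3u^n,\varphi)+\varepsilon^2(\nabla u^n,\nabla\varphi)+\int_\Omega\bigl((u^n)^3-u^n\bigr)\varphi\,dx=0 .$$ The discrete Ginzburg–Landau energy is $E(u)=\frac{\varepsilon^2}{2}\|\nabla u\|^2+\frac14\|u^2-1\|^2$ for $u\in V$. **Theorem.** Let $\gamma=1/200$. Assume that $r_n\le 1.405$ for $2\le n\le N$, and that $\tau_n\le\min\{\beta_n,\,2\gamma\}$ for $1\le n\le N$, where $$\beta_1=1,\qquad \beta_2=\frac{1+2r_2}{1+r_2},\qquad \beta_n=\frac{1+2r_n+r_{n-1}(1+4r_n+3r_n^2)}{(1+r_n)(1+r_{n-1}+r_nr_{n-1})}\quad(n\ge3),$$ that is, $\beta_n=\tau_nb_0^{(n)}$. Then every solution $u^0,\dots,u^N$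 of the variable-step BDF3 scheme satisfies $$E(u^n)\le E(u^0),\qquad 1\le n\le N .$$ -/

import Mathlib

open MeasureTheory
open scoped ContDiff

noncomputable section

namespace AllenCahnBDF3

/-! ### Time grid and the variable-step BDF3 kernels -/

/-- The step size `τ_k = t_k - t_{k-1}`, used for `k ≥ 1`. -/
def stepSize (t : ℕ → ℝ) (k : ℕ) : ℝ := t k - t (k - 1)

/-- The adjacent step ratio `r_k = τ_k / τ_{k-1}`, used for `k ≥ 2`. -/
def stepRatio (t : ℕ → ℝ) (k : ℕ) : ℝ := stepSize t k / stepSize t (k - 1)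

/-- The kernels `b_0^{(n)}, b_1^{(n)}, b_2^{(n)}` of the three-step formula (for `n ≥ 3`),
as functions of `r = r_n`, `s = r_{n-1}` and `τ = τ_n`; they vanish for `j ≥ 3`. -/
def bdf3Coeff (r s τ : ℝ) : ℕ → ℝ
  | 0 => ((1 + s) * (1 + 2 * r + s * (1 + 4 * r + 3 * r ^ 2))) /
      (τ * (1 + r) * (1 + s) * (1 + s + r * s))
  | 1 => -((r ^ 2 * ((1 + 2 * s + r * s) ^ 2 - s * (1 + s))) /
      (τ * (1 + r) * (1 + s) * (1 + s + r * s)))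
  | 2 => (r ^ 2 * s ^ 3 * (1 + r) ^ 2) / (τ * (1 + r) * (1 + s) * (1 + s + r * s))
  | _ => 0

/-- The kernels of the two-step formula, with `r = r_2` and `τ = τ_2`. -/
def bdf2Coeff (r τ : ℝ) : ℕ → ℝ
  | 0 => (1 + 2 * r) / (τ * (1 + r))
  | 1 => -(r ^ 2 / (τ * (1 + r)))
  | _ => 0

/-- The kernel of the one-step formula, with `τ = τ_1`. -/
def bdf1Coeff (τ : ℝ) : ℕ → ℝ
  | 0 => 1 / τ
  | _ => 0

/-- The discrete convolution kernels `b_j^{(n)}` for `n ≥ 1`: one-step formula at the first level,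
two-step formula at the second level, three-step formula from the third level on. -/
def kernel (t : ℕ → ℝ) (n j : ℕ) : ℝ :=
  if n = 1 then bdf1Coeff (stepSize t 1) j
  else if n = 2 then bdf2Coeff (stepRatio t 2) (stepSize t 2) j
  else bdf3Coeff (stepRatio t n) (stepRatio t (n - 1)) (stepSize t n) j

/-- The discrete time derivative `D_3 v^n = ∑_{k=1}^n b_{n-k}^{(n)} (v^k - v^{k-1})`. -/
def D3 (t : ℕ → ℝ) (v : ℕ → ℝ) (n : ℕ) : ℝ :=
  ∑ k ∈ Finset.Icc 1 n, kernel t n (n - k) * (v k - v (k - 1))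

/-- The first upper bound in the step size condition. At `n = 1` and `n = 2`, where `r_n` or
`r_{n-1}` does not exist, it is the quantity `τ_n b_0^{(n)}` of the one- and two-step formulas, as
the general expression is for `n ≥ 3`. -/
def solvabilityBound (t : ℕ → ℝ) (n : ℕ) : ℝ :=
  if n = 1 then 1
  else if n = 2 then (1 + 2 * stepRatio t 2) / (1 + stepRatio t 2)
  else
    (1 + 2 * stepRatio t n + stepRatio t (n - 1) * (1 + 4 * stepRatio t n + 3 * stepRatio t n ^ 2)) /
      ((1 + stepRatio t n) * (1 + stepRatio t (n - 1) + stepRatio t n * stepRatio t (n - 1)))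

/-! ### Periodic functions on a box -/

/-- The open box `Ω = ∏ᵢ (aᵢ, bᵢ)`. -/
def box {d : ℕ} (a b : Fin d → ℝ) : Set (EuclideanSpace ℝ (Fin d)) :=
  {x | ∀ i, x i ∈ Set.Ioo (a i) (b i)}

/-- Smooth functions on `ℝ^d` that are `Ω`-periodic, i.e. of period `bᵢ - aᵢ` in the `i`-th
variable. -/
def IsSmoothPeriodic {d : ℕ} (a b : Fin d → ℝ) (φ : EuclideanSpace ℝ (Fin d) → ℝ) : Prop :=
  ContDiff ℝ ∞ φ ∧ ∀ x i, φ (x + EuclideanSpace.single i (b i - a i)) = φ x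

/-- `g` is the weak gradient of `u` on the periodic box. Since the test functions are periodic
(and need not vanish at the boundary of `Ω`), this contains the periodic boundary condition on
`u`. Only the restrictions of `u` and `g` to `Ω` matter. -/
def IsPeriodicWeakGradient {d : ℕ} (a b : Fin d → ℝ) (u : EuclideanSpace ℝ (Fin d) → ℝ)
    (g : EuclideanSpace ℝ (Fin d) → EuclideanSpace ℝ (Fin d)) : Prop :=
  ∀ φ : EuclideanSpace ℝ (Fin d) → ℝ, IsSmoothPeriodic a b φ → ∀ i : Fin d,
    ∫ x in box a b, u x * fderiv ℝ φ x (EuclideanSpace.single i 1) =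
      -∫ x in box a b, g x i * φ x

/-- The energy space `H¹_per(Ω) ∩ L⁴(Ω)`, on which the Ginzburg–Landau energy is finite. An element
is a function together with (a representative of) its weak gradient, which is determined almost
everywhere on `Ω` by the function. As `Ω` is bounded, `L⁴(Ω) ⊆ L²(Ω)`. -/
structure EnergySpace {d : ℕ} (a b : Fin d → ℝ) where
  /-- the function -/
  val : EuclideanSpace ℝ (Fin d) → ℝ
  /-- its weak gradient -/
  grad : EuclideanSpace ℝ (Fin d) → EuclideanSpace ℝ (Fin d)
  val_memLp : MemLp val 4 (volume.restrict (box a b))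
  grad_memLp : MemLp grad 2 (volume.restrict (box a b))
  isWeakGradient : IsPeriodicWeakGradient a b val grad

/-! ### The scheme and the energy -/

/-- `u^0, …, u^N` solves the variable-step BDF3 scheme
`D_3 u^n - ε² Δ u^n + (u^n)³ - u^n = 0`, `1 ≤ n ≤ N`, with periodic boundary conditions. The
equation holds in the weak sense: `(D_3 u^n, φ) + ε² (∇u^n, ∇φ) + ((u^n)³ - u^n, φ) = 0` for every
`φ` in the energy space. -/
def IsBDF3Solution {d : ℕ} {a b : Fin d → ℝ} (ε : ℝ) (t : ℕ → ℝ) (N : ℕ)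
    (u : ℕ → EnergySpace a b) : Prop :=
  ∀ n, 1 ≤ n → n ≤ N → ∀ φ : EnergySpace a b,
    (∫ x in box a b, D3 t (fun k => (u k).val x) n * φ.val x)
      + ε ^ 2 * (∫ x in box a b, inner ℝ ((u n).grad x) (φ.grad x))
      + (∫ x in box a b, ((u n).val x ^ 3 - (u n).val x) * φ.val x) = 0

/-- The Ginzburg–Landau energy `E(u) = (ε²/2) ‖∇u‖² + (1/4) ‖u² - 1‖²`, with norms in `L²(Ω)`. -/
def energy {d : ℕ} {a b : Fin d → ℝ} (ε : ℝ) (u : EnergySpace a b) : ℝ :=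
  ε ^ 2 / 2 * (∫ x in box a b, ‖u.grad x‖ ^ 2)
    + 1 / 4 * (∫ x in box a b, (u.val x ^ 2 - 1) ^ 2)

end AllenCahnBDF3

end

namespace AllenCahnBDF3

/-! Testing the scheme with `u^n - u^{n-1}` and using convexity of the gradient term and
semiconvexity of the double well bounds the energy increment by the integral of `-(D_3 u^n) δ +
δ²/2`, where `δ = u^n - u^{n-1}` (`energy_sub_add_le_zero`). It remains to control `∑ (D_3 v^k δ^k -
(δ^k)²/2)` for real sequences `v`, pointwise in `x`. The kernels have a discrete gradient structure:
with `y_n = δ^n/τ_n` and `G_n = τ_n (4/5 y_n² + r_n/4 (y_{n-1} - y_n)²)`, one has `D_3 v^n δ^n ≥ G_n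
- G_{n-1} + γ (δ^n)²/τ_n` (`D3_mul_sub_ge`). As `τ_n ≤ 2γ`, the last term absorbs `(δ^n)²/2`; the
rest telescopes to `G_n ≥ 0`. The gradient structure is the nonnegativity of a quadratic form in
three variables (`dissipation_form_nonneg`): one is eliminated by completing a square, and the
remaining binary form is checked by its discriminant. -/

/-! ### The quadratic form of the three-step kernels -/

theorem discriminant_at_zero {r : ℝ} (hr : 0 ≤ r) (hr' : r ≤ 1.405) :
    0 ≤ (39 / 250 - r / 5 - 39 / 800 * r ^ 2) * (1 + r) ^ 2 + 4 / 5 * r * (1 + r) - r ^ 3 / 4 := by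
  nlinarith [mul_nonneg hr (sub_nonneg.2 hr'), mul_nonneg (pow_nonneg hr 2) (sub_nonneg.2 hr'),
    mul_nonneg (pow_nonneg hr 3) (sub_nonneg.2 hr')]

theorem discriminant_at_max {r : ℝ} (hr : 0 ≤ r) (hr' : r ≤ 1.405) :
    0 ≤ (39 / 250 - r / 5 - 39 / 800 * r ^ 2 - r ^ 3 * (39 / 50) ^ 2 / 5
        + r ^ 5 * (39 / 50) ^ 2 / 16) * (1 + r) ^ 2
      + 4 / 5 * r * (1 + r) * (1 + 39 / 50) - r ^ 3 * (1 + 39 / 50) ^ 2 / 4 := by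
  have h := sub_nonneg.2 hr'
  nlinarith [mul_nonneg hr h, mul_nonneg (pow_nonneg hr 2) h,
    mul_nonneg (pow_nonneg hr 3) h, mul_nonneg (pow_nonneg hr 4) h, mul_nonneg (pow_nonneg hr 5) h,
    mul_nonneg (pow_nonneg hr 6) h, pow_nonneg hr 7]

/-- The expression is quadratic in `m`, and concave because `r² ≤ 16/5`, so the endpoints `m = 0`
and `m = 39/50` suffice. -/
theorem discriminant_nonneg {r m : ℝ} (hr : 0 ≤ r) (hr' : r ≤ 1.405) (hm : 0 ≤ m)
    (hm' : m ≤ 39 / 50) :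
    0 ≤ (39 / 250 - r / 5 - 39 / 800 * r ^ 2 - r ^ 3 * m ^ 2 / 5 + r ^ 5 * m ^ 2 / 16) * (1 + r) ^ 2
      + 4 / 5 * r * (1 + r) * (1 + m) - r ^ 3 * (1 + m) ^ 2 / 4 := by
  have h0 := discriminant_at_zero hr hr'
  have h1 := discriminant_at_max hr hr'
  have hr2 : 0 ≤ 16 / 5 - r ^ 2 := by norm_num at hr'; nlinarith
  -- The first factor is minus the coefficient of `m²`; this is the excess of the concave quadratic
  -- over its chord.
  have hC : 0 ≤ (r ^ 3 * (1 + r) ^ 2 * (16 / 5 - r ^ 2) / 16 + r ^ 3 / 4) * (m * (39 / 50 - m)) := by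
    have := sub_nonneg.2 hm'
    positivity
  have h0' := mul_nonneg (sub_nonneg.2 hm') h0
  have h1' := mul_nonneg hm h1
  linarith

theorem quadratic_form_nonneg {a b c : ℝ} (hc : 0 < c) (h : b ^ 2 ≤ a * c) (x y : ℝ) :
    0 ≤ a * x ^ 2 + 2 * b * x * y + c * y ^ 2 := by
  have h1 : 0 ≤ c * (a * x ^ 2 + 2 * b * x * y + c * y ^ 2) := by
    nlinarith [sq_nonneg (c * y + b * x), mul_nonneg (sub_nonneg.2 h) (sq_nonneg x)]
  exact nonneg_of_mul_nonneg_right h1 hc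

/-- What is left of the dissipation form once `z` is eliminated. Multiplied by `r`, it is a binary
form in `y`, `e`, where `39/200 = 1 - 4/5 - 1/200`; its determinant is the expression of
`discriminant_nonneg` times `r/(1+r)²`. -/
theorem reduced_form_nonneg {r m : ℝ} (hr : 0 < r) (hr' : r ≤ 1.405) (hm : 0 ≤ m)
    (hm' : m ≤ 39 / 50) (y e : ℝ) :
    0 ≤ y * (y - r * (1 + m) / (1 + r) * e) - r ^ 3 * m ^ 2 / 4 * y ^ 2 - 1 / 200 * y ^ 2
      - (4 / 5 * y ^ 2 + r / 4 * e ^ 2) + 4 / 5 * (y + e) ^ 2 / r := by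
  have hD := discriminant_nonneg hr.le hr' hm hm'
  have hc : 0 < 4 / 5 - r ^ 2 / 4 := by norm_num at hr'; nlinarith
  have hdet : (4 / 5 - r ^ 2 * (1 + m) / (2 * (1 + r))) ^ 2
      ≤ (4 / 5 + 39 / 200 * r - r ^ 4 * m ^ 2 / 4) * (4 / 5 - r ^ 2 / 4) := by
    rw [← sub_nonneg]
    have : (4 / 5 + 39 / 200 * r - r ^ 4 * m ^ 2 / 4) * (4 / 5 - r ^ 2 / 4)
        - (4 / 5 - r ^ 2 * (1 + m) / (2 * (1 + r))) ^ 2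
        = r / (1 + r) ^ 2 * ((39 / 250 - r / 5 - 39 / 800 * r ^ 2 - r ^ 3 * m ^ 2 / 5
          + r ^ 5 * m ^ 2 / 16) * (1 + r) ^ 2
          + 4 / 5 * r * (1 + r) * (1 + m) - r ^ 3 * (1 + m) ^ 2 / 4) := by
      field_simp
      ring
    rw [this]
    positivity
  have hq := quadratic_form_nonneg hc hdet y e
  have : y * (y - r * (1 + m) / (1 + r) * e) - r ^ 3 * m ^ 2 / 4 * y ^ 2 - 1 / 200 * y ^ 2
      - (4 / 5 * y ^ 2 + r / 4 * e ^ 2) + 4 / 5 * (y + e) ^ 2 / r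
      = ((4 / 5 + 39 / 200 * r - r ^ 4 * m ^ 2 / 4) * y ^ 2
        + 2 * (4 / 5 - r ^ 2 * (1 + m) / (2 * (1 + r))) * y * e + (4 / 5 - r ^ 2 / 4) * e ^ 2) / r := by
    field_simp
    ring
  rw [this]
  positivity

/-- Completing the square in `z` costs `r³ m² s/(1+s)² y²`, and `s/(1+s)² ≤ 1/4` removes the
dependence on `s` outside `m`. -/
theorem weighted_square_bound {r s : ℝ} (hr : 0 < r) (hs : 0 ≤ s) (m y z : ℝ) :
    -(r ^ 3 * m ^ 2 / 4 * y ^ 2) ≤ y * (r * m * s / (1 + s) * z) + s / 4 * z ^ 2 / r := by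
  have hs4 : s / (1 + s) ^ 2 ≤ 1 / 4 := by
    rw [div_le_div_iff₀ (by positivity) (by norm_num)]
    nlinarith [sq_nonneg (1 - s)]
  have h1 : 0 ≤ r ^ 3 * m ^ 2 * y ^ 2 * (1 / 4 - s / (1 + s) ^ 2) := by
    have := sub_nonneg.2 hs4
    positivity
  have h2 : 0 ≤ s / (4 * r) * (z + 2 * r ^ 2 * m / (1 + s) * y) ^ 2 := by positivity
  have : y * (r * m * s / (1 + s) * z) + s / 4 * z ^ 2 / r
      = s / (4 * r) * (z + 2 * r ^ 2 * m / (1 + s) * y) ^ 2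
        + r ^ 3 * m ^ 2 * y ^ 2 * (1 / 4 - s / (1 + s) ^ 2) - r ^ 3 * m ^ 2 / 4 * y ^ 2 := by
    field_simp
    ring
  rw [this]
  linarith

/-- The dissipation inequality of the three-step formula, in terms of the last difference quotient
`y` and of the increments `e`, `z` of the difference quotients (backwards in time). -/
theorem dissipation_form_nonneg {r s : ℝ} (hr : 0 < r) (hr' : r ≤ 1.405) (hs : 0 ≤ s)
    (hs' : s ≤ 1.405) (y e z : ℝ) :
    0 ≤ y * (y - r * (1 + s * (1 + r) / (1 + s + r * s)) / (1 + r) * e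
          + r * (s * (1 + r) / (1 + s + r * s)) * s / (1 + s) * z)
      - 1 / 200 * y ^ 2 - (4 / 5 * y ^ 2 + r / 4 * e ^ 2)
      + (4 / 5 * (y + e) ^ 2 + s / 4 * z ^ 2) / r := by
  -- This quotient plays the role of `m`. It increases in `r` and `s`, and is about `0.772` at `r =
  -- s = 1.405`, hence the bound `39/50`.
  have hm : 0 ≤ s * (1 + r) / (1 + s + r * s) := by positivity
  have hm' : s * (1 + r) / (1 + s + r * s) ≤ 39 / 50 := by
    rw [div_le_iff₀ (by positivity)]
    norm_num at hr' hs'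
    nlinarith
  have h1 := reduced_form_nonneg hr hr' hm hm' y e
  have h2 := weighted_square_bound hr hs (s * (1 + r) / (1 + s + r * s)) y z
  rw [add_div, mul_add]
  linarith

/-! ### Discrete gradient structure of `D_3` -/

/-- The difference quotient `(v^n - v^{n-1}) / τ_n`. -/
noncomputable def diffQuotient (t v : ℕ → ℝ) (n : ℕ) : ℝ := (v n - v (n - 1)) / stepSize t n

/-- The quadratic functional whose increments bound `(D_3 v^n) (v^n - v^{n-1})` from below. -/
noncomputable def gradientFunctional (t v : ℕ → ℝ) (n : ℕ) : ℝ :=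
  stepSize t n * (4 / 5 * diffQuotient t v n ^ 2
    + stepRatio t n / 4 * (diffQuotient t v (n - 1) - diffQuotient t v n) ^ 2)

theorem stepSize_zero (t : ℕ → ℝ) : stepSize t 0 = 0 := by simp [stepSize]

/-- Division by `τ_0 = 0` gives `r_1 = 0`, which drops the undefined difference `y_0 - y_1` from the
functional at level 1. -/
theorem stepRatio_one (t : ℕ → ℝ) : stepRatio t 1 = 0 := by simp [stepRatio, stepSize_zero]

theorem gradientFunctional_zero (t v : ℕ → ℝ) : gradientFunctional t v 0 = 0 := by
  simp [gradientFunctional, stepSize_zero]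

theorem D3_one (t v : ℕ → ℝ) : D3 t v 1 = 1 / stepSize t 1 * (v 1 - v 0) := by
  simp [D3, kernel, bdf1Coeff]

theorem D3_two (t v : ℕ → ℝ) :
    D3 t v 2 = bdf2Coeff (stepRatio t 2) (stepSize t 2) 0 * (v 2 - v 1)
      + bdf2Coeff (stepRatio t 2) (stepSize t 2) 1 * (v 1 - v 0) := by
  have : Finset.Icc 1 2 = {1, 2} := by decide
  rw [D3, this, Finset.sum_pair (by norm_num)]
  simp [kernel, add_comm]

theorem D3_add_three (t v : ℕ → ℝ) (n : ℕ) :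
    D3 t v (n + 3)
      = bdf3Coeff (stepRatio t (n + 3)) (stepRatio t (n + 2)) (stepSize t (n + 3)) 0
          * (v (n + 3) - v (n + 2))
        + bdf3Coeff (stepRatio t (n + 3)) (stepRatio t (n + 2)) (stepSize t (n + 3)) 1
          * (v (n + 2) - v (n + 1))
        + bdf3Coeff (stepRatio t (n + 3)) (stepRatio t (n + 2)) (stepSize t (n + 3)) 2
          * (v (n + 1) - v n) := by
  have hk : ∀ j, kernel t (n + 3) j
      = bdf3Coeff (stepRatio t (n + 3)) (stepRatio t (n + 2)) (stepSize t (n + 3)) j := by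
    intro j
    simp [kernel]
  rw [D3, Finset.sum_Icc_succ_top (by omega), Finset.sum_Icc_succ_top (by omega),
    Finset.sum_Icc_succ_top (by omega), Finset.sum_eq_zero]
  · simp only [hk]
    rw [show n + 2 + 1 - (n + 2 + 1) = 0 by omega, show n + 3 - (n + 1 + 1) = 1 by omega,
      show n + 3 - (n + 1) = 2 by omega]
    simp only [Nat.add_sub_cancel]
    ring_nf
  · intro k hk'
    obtain ⟨j, hj⟩ : ∃ j, n + 3 - k = j + 3 := ⟨n - k, by have := (Finset.mem_Icc.1 hk').2; omega⟩
    rw [hk, hj]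
    simp [bdf3Coeff]

theorem D3_mul_sub_ge {N : ℕ} {t : ℕ → ℝ} (ht : ∀ k, 1 ≤ k → k ≤ N → t (k - 1) < t k)
    (hr : ∀ n, 2 ≤ n → n ≤ N → stepRatio t n ≤ 1.405) (v : ℕ → ℝ) {n : ℕ} (hn : 1 ≤ n)
    (hnN : n ≤ N) :
    gradientFunctional t v n - gradientFunctional t v (n - 1)
        + 1 / 200 * ((v n - v (n - 1)) ^ 2 / stepSize t n)
      ≤ D3 t v n * (v n - v (n - 1)) := by
  have hpos : ∀ k, 1 ≤ k → k ≤ N → 0 < stepSize t k := fun k h1 h2 => sub_pos.2 (ht k h1 h2)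
  obtain rfl | rfl | ⟨n, rfl⟩ : n = 1 ∨ n = 2 ∨ ∃ k, n = k + 3 := by
    rcases n with _ | _ | _ | k
    · omega
    · simp
    · simp
    · exact Or.inr (Or.inr ⟨k, rfl⟩)
  -- Level 1 reduces to `4/5 + 1/200 ≤ 1`.
  · have h1 := hpos 1 le_rfl hnN
    rw [Nat.sub_self, gradientFunctional_zero, D3_one, gradientFunctional, stepRatio_one,
      diffQuotient]
    have : 0 ≤ (v 1 - v 0) ^ 2 / stepSize t 1 := by positivity
    have e1 : stepSize t 1 * (4 / 5 * ((v 1 - v (1 - 1)) / stepSize t 1) ^ 2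
        + 0 / 4 * (diffQuotient t v (1 - 1) - (v 1 - v (1 - 1)) / stepSize t 1) ^ 2)
        = 4 / 5 * ((v 1 - v 0) ^ 2 / stepSize t 1) := by
      field_simp
      simp
    have e2 : 1 / stepSize t 1 * (v 1 - v 0) * (v 1 - v 0) = (v 1 - v 0) ^ 2 / stepSize t 1 := by
      ring
    rw [e1, e2]
    linarith
  · have h1 := hpos 1 le_rfl (by omega)
    have h2 := hpos 2 (by omega) hnN
    have hr2 : 0 < stepRatio t 2 := div_pos h2 h1
    -- The two-step formula is the degenerate case `s = 0`, `z = 0` of the three-step one.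
    have key := dissipation_form_nonneg hr2 (hr 2 le_rfl hnN) le_rfl (by norm_num)
      (diffQuotient t v 2) (diffQuotient t v 1 - diffQuotient t v 2) 0
    have hv2 : v 2 - v 1 = stepSize t 2 * diffQuotient t v 2 := by
      rw [diffQuotient, mul_div_cancel₀ _ h2.ne']
    have h12 : stepSize t 1 = stepSize t 2 / stepRatio t 2 := by
      rw [stepRatio]; field_simp
    have hv1 : v 1 - v 0 = stepSize t 1 * diffQuotient t v 1 := by
      rw [diffQuotient, mul_div_cancel₀ _ h1.ne']
    simp only [gradientFunctional, Nat.add_one_sub_one, stepRatio_one, D3_two,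
      bdf2Coeff, hv2, hv1, h12]
    generalize diffQuotient t v 2 = y at *
    generalize diffQuotient t v 1 = y' at *
    generalize stepRatio t 2 = r at *
    generalize stepSize t 2 = τ at *
    rw [← sub_nonneg]
    have key' := mul_nonneg h2.le key
    refine key'.trans_eq ?_
    field_simp
    ring
  · have h1 := hpos (n + 1) (by omega) (by omega)
    have h2 := hpos (n + 2) (by omega) (by omega)
    have h3 := hpos (n + 3) (by omega) (by omega)
    have hr3 : 0 < stepRatio t (n + 3) := div_pos h3 h2
    have hr2 : 0 < stepRatio t (n + 2) := div_pos h2 h1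
    have key := dissipation_form_nonneg hr3 (hr _ (by omega) hnN) hr2.le
      (hr _ (by omega) (by omega))
      (diffQuotient t v (n + 3)) (diffQuotient t v (n + 2) - diffQuotient t v (n + 3))
      (diffQuotient t v (n + 1) - diffQuotient t v (n + 2))
    have hv3 : v (n + 3) - v (n + 2) = stepSize t (n + 3) * diffQuotient t v (n + 3) := by
      rw [diffQuotient, mul_div_cancel₀ _ h3.ne', show n + 3 - 1 = n + 2 from rfl]
    have hv2 : v (n + 2) - v (n + 1) = stepSize t (n + 2) * diffQuotient t v (n + 2) := by
      rw [diffQuotient, mul_div_cancel₀ _ h2.ne', show n + 2 - 1 = n + 1 from rfl]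
    have hv1 : v (n + 1) - v n = stepSize t (n + 1) * diffQuotient t v (n + 1) := by
      rw [diffQuotient, mul_div_cancel₀ _ h1.ne', show n + 1 - 1 = n from rfl]
    have h23 : stepSize t (n + 2) = stepSize t (n + 3) / stepRatio t (n + 3) := by
      rw [stepRatio, show n + 3 - 1 = n + 2 from rfl]; field_simp
    have h12 : stepSize t (n + 1) = stepSize t (n + 2) / stepRatio t (n + 2) := by
      rw [stepRatio, show n + 2 - 1 = n + 1 from rfl]; field_simp
    simp only [gradientFunctional, show n + 3 - 1 = n + 2 from rfl, show n + 2 - 1 = n + 1 from rfl,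
      D3_add_three, bdf3Coeff, hv3, hv2, hv1, h12, h23]
    generalize diffQuotient t v (n + 3) = y at *
    generalize diffQuotient t v (n + 2) = y' at *
    generalize diffQuotient t v (n + 1) = y'' at *
    generalize stepRatio t (n + 3) = r at *
    generalize stepRatio t (n + 2) = s at *
    generalize stepSize t (n + 3) = τ at *
    rw [← sub_nonneg]
    -- In difference quotients, the claim is exactly `τ_n` times the dissipation form.
    refine (mul_nonneg h3.le key).trans_eq ?_
    field_simp
    ring

theorem gradientFunctional_nonneg {t : ℕ → ℝ} {n : ℕ} (h : 0 ≤ stepSize t n)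
    (hr : 0 ≤ stepRatio t n) (v : ℕ → ℝ) : 0 ≤ gradientFunctional t v n := by
  rw [gradientFunctional]
  positivity

theorem sum_D3_mul_sub_nonneg {N : ℕ} {t : ℕ → ℝ} (ht : ∀ k, 1 ≤ k → k ≤ N → t (k - 1) < t k)
    (hr : ∀ n, 2 ≤ n → n ≤ N → stepRatio t n ≤ 1.405)
    (hτ : ∀ n, 1 ≤ n → n ≤ N → stepSize t n ≤ 2 * (1 / 200)) (v : ℕ → ℝ) {n : ℕ}
    (hnN : n ≤ N) :
    0 ≤ ∑ k ∈ Finset.Icc 1 n,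
      (D3 t v k * (v k - v (k - 1)) - 1 / 2 * (v k - v (k - 1)) ^ 2) := by
  have hpos : ∀ k, 1 ≤ k → k ≤ N → 0 < stepSize t k := fun k h1 h2 => sub_pos.2 (ht k h1 h2)
  have hsum : ∀ n, n ≤ N → gradientFunctional t v n ≤ ∑ k ∈ Finset.Icc 1 n,
      (D3 t v k * (v k - v (k - 1)) - 1 / 2 * (v k - v (k - 1)) ^ 2) := by
    intro n
    induction n with
    | zero => simp [gradientFunctional_zero]
    | succ n ih =>
      intro hn
      have h1 := D3_mul_sub_ge ht hr v (Nat.le_add_left 1 n) hn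
      -- The bound `τ ≤ 2γ` enters here: `γ/τ ≥ 1/2`.
      have h2 : 1 / 2 * (v (n + 1) - v n) ^ 2
          ≤ 1 / 200 * ((v (n + 1) - v n) ^ 2 / stepSize t (n + 1)) := by
        have hp := hpos (n + 1) (by omega) hn
        rw [mul_div_assoc', le_div_iff₀ hp]
        nlinarith [mul_nonneg (sub_nonneg.2 (hτ (n + 1) (by omega) hn))
          (sq_nonneg (v (n + 1) - v n))]
      rw [Finset.sum_Icc_succ_top (by omega)]
      simp only [Nat.add_sub_cancel] at h1 ⊢
      linarith [ih (by omega)]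
  refine le_trans ?_ (hsum n hnN)
  rcases n with _ | n
  · rw [gradientFunctional_zero]
  · refine gradientFunctional_nonneg (hpos _ (by omega) hnN).le ?_ v
    rcases n with _ | n
    · rw [zero_add, stepRatio_one]
    · exact div_nonneg (hpos _ (by omega) hnN).le (hpos _ (by omega) (by omega)).le

/-! ### Integrability on the box and differences in the energy space -/

variable {d : ℕ} {a b : Fin d → ℝ}

theorem exists_isCompact_box_subset (a b : Fin d → ℝ) :
    ∃ K : Set (EuclideanSpace ℝ (Fin d)), IsCompact K ∧ box a b ⊆ K := by
  refine ⟨(EuclideanSpace.equiv (Fin d) ℝ).toHomeomorph ⁻¹'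
    Set.pi Set.univ fun i => Set.Icc (a i) (b i), ?_, ?_⟩
  · rw [Homeomorph.isCompact_preimage]
    exact isCompact_univ_pi fun i => isCompact_Icc
  · intro x hx i _
    exact Set.Ioo_subset_Icc_self (hx i)

theorem measurableSet_box (a b : Fin d → ℝ) : MeasurableSet (box a b) := by
  have : box a b = ⋂ i, {x | x i ∈ Set.Ioo (a i) (b i)} := by
    ext x
    simp [box]
  rw [this]
  refine MeasurableSet.iInter fun i => ?_
  exact (by fun_prop : Measurable fun x : EuclideanSpace ℝ (Fin d) => x i) measurableSet_Ioo

theorem isFiniteMeasure_restrict_box (a b : Fin d → ℝ) :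
    IsFiniteMeasure (volume.restrict (box a b)) := by
  obtain ⟨K, hK, hsub⟩ := exists_isCompact_box_subset a b
  refine isFiniteMeasure_restrict.2 (ne_top_of_le_ne_top hK.measure_lt_top.ne (measure_mono hsub))

theorem integrable_mul_continuous {f φ : EuclideanSpace ℝ (Fin d) → ℝ}
    (hf : Integrable f (volume.restrict (box a b))) (hφ : Continuous φ) :
    Integrable (fun x => f x * φ x) (volume.restrict (box a b)) := by
  obtain ⟨K, hK, hsub⟩ := exists_isCompact_box_subset a b
  obtain ⟨C, hC⟩ := hK.exists_bound_of_continuousOn hφ.continuousOn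
  refine hf.mul_bdd (c := C) hφ.aestronglyMeasurable ?_
  exact (ae_restrict_mem (measurableSet_box a b)).mono fun x hx => hC x (hsub hx)

namespace EnergySpace

theorem integrable_val (u : EnergySpace a b) : Integrable u.val (volume.restrict (box a b)) := by
  have := isFiniteMeasure_restrict_box a b
  exact u.val_memLp.integrable (by norm_num)

theorem integrable_grad_apply (u : EnergySpace a b) (i : Fin d) :
    Integrable (fun x => u.grad x i) (volume.restrict (box a b)) := by
  have := isFiniteMeasure_restrict_box a b
  exact (EuclideanSpace.proj (𝕜 := ℝ) i).integrable_comp (u.grad_memLp.integrable (by norm_num))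

/-- The difference of two elements of the energy space. -/
def sub (u v : EnergySpace a b) : EnergySpace a b where
  val x := u.val x - v.val x
  grad x := u.grad x - v.grad x
  val_memLp := u.val_memLp.sub v.val_memLp
  grad_memLp := u.grad_memLp.sub v.grad_memLp
  isWeakGradient := by
    intro φ hφ i
    have hφ' : Continuous fun x => fderiv ℝ φ x (EuclideanSpace.single i 1) :=
      (hφ.1.continuous_fderiv (by simp)).clm_apply continuous_const
    simp only [sub_mul, PiLp.sub_apply]
    -- Splitting the integrals is legitimate since `φ` and its derivatives are continuous, hence
    -- bounded on the bounded box.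
    rw [integral_sub (integrable_mul_continuous u.integrable_val hφ')
        (integrable_mul_continuous v.integrable_val hφ'),
      integral_sub (integrable_mul_continuous (u.integrable_grad_apply i) hφ.1.continuous)
        (integrable_mul_continuous (v.integrable_grad_apply i) hφ.1.continuous),
      u.isWeakGradient φ hφ i, v.isWeakGradient φ hφ i]
    ring

theorem integrable_val_pow_four (u : EnergySpace a b) :
    Integrable (fun x => u.val x ^ 4) (volume.restrict (box a b)) := by
  have h := u.val_memLp.integrable_norm_pow (p := 4) (by norm_num)
  refine h.congr (Filter.Eventually.of_forall fun x => ?_)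
  simp only [Real.norm_eq_abs]
  exact Even.pow_abs (by decide) _

theorem aestronglyMeasurable_val (u : EnergySpace a b) :
    AEStronglyMeasurable u.val (volume.restrict (box a b)) := u.val_memLp.1

theorem integrable_potential (u : EnergySpace a b) :
    Integrable (fun x => (u.val x ^ 2 - 1) ^ 2) (volume.restrict (box a b)) := by
  have := isFiniteMeasure_restrict_box a b
  refine ((u.integrable_val_pow_four.const_mul 2).add (integrable_const (2 : ℝ))).mono'
    (((u.aestronglyMeasurable_val.pow 2).sub aestronglyMeasurable_const).pow 2)
    (Filter.Eventually.of_forall fun x => ?_)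
  simp only [Real.norm_eq_abs, Pi.add_apply]
  rw [abs_of_nonneg (by positivity)]
  nlinarith [sq_nonneg (u.val x ^ 2 + 1)]

theorem integrable_cubic_mul_sub (u v : EnergySpace a b) :
    Integrable (fun x => (u.val x ^ 3 - u.val x) * (u.val x - v.val x))
      (volume.restrict (box a b)) := by
  have := isFiniteMeasure_restrict_box a b
  refine (((u.integrable_val_pow_four.const_mul 4).add
    (v.integrable_val_pow_four.const_mul 4)).add (integrable_const (4 : ℝ))).mono'
    (((u.aestronglyMeasurable_val.pow 3).sub u.aestronglyMeasurable_val).mul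
      (u.aestronglyMeasurable_val.sub v.aestronglyMeasurable_val))
    (Filter.Eventually.of_forall fun x => ?_)
  simp only [Real.norm_eq_abs, Pi.add_apply]
  generalize u.val x = p
  generalize v.val x = q
  rw [abs_le]
  constructor <;>
  nlinarith [sq_nonneg (p ^ 2 - 1), sq_nonneg (q ^ 2 - 1), sq_nonneg (p ^ 2 - p * q),
    sq_nonneg (p ^ 2 + p * q), sq_nonneg (p * q - q ^ 2), sq_nonneg (p * q + q ^ 2),
    sq_nonneg (p ^ 2 - q ^ 2), sq_nonneg (p + q), sq_nonneg (p - q)]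

theorem memLp_two_val (u : EnergySpace a b) : MemLp u.val 2 (volume.restrict (box a b)) := by
  have := isFiniteMeasure_restrict_box a b
  exact u.val_memLp.mono_exponent (by norm_num)

theorem integrable_norm_grad_sq (u : EnergySpace a b) :
    Integrable (fun x => ‖u.grad x‖ ^ 2) (volume.restrict (box a b)) :=
  u.grad_memLp.integrable_norm_pow (p := 2) (by norm_num)

theorem integrable_inner_grad (u v : EnergySpace a b) :
    Integrable (fun x => inner ℝ (u.grad x) (v.grad x)) (volume.restrict (box a b)) := by
  refine (u.integrable_norm_grad_sq.add v.integrable_norm_grad_sq).mono'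
    (u.grad_memLp.1.inner v.grad_memLp.1) (Filter.Eventually.of_forall fun x => ?_)
  refine (norm_inner_le_norm _ _).trans ?_
  simp only [Pi.add_apply]
  nlinarith [sq_nonneg (‖u.grad x‖ - ‖v.grad x‖), sq_nonneg (‖u.grad x‖), sq_nonneg (‖v.grad x‖)]

end EnergySpace

/-! ### Energy estimates -/

/-- With `W(p) = (p² - 1)²/4`, `W'' = 3p² - 1 ≥ -1`, so `W(p) + p²/2` is convex and lies above its
tangent at `p`. -/
theorem double_well_sub_le (p q : ℝ) :
    1 / 4 * (p ^ 2 - 1) ^ 2 - 1 / 4 * (q ^ 2 - 1) ^ 2 - 1 / 2 * (p - q) ^ 2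
      ≤ (p ^ 3 - p) * (p - q) := by
  nlinarith [sq_nonneg (p ^ 2 - q ^ 2), sq_nonneg (p * (p - q))]

theorem norm_sq_sub_le_inner {E : Type*} [NormedAddCommGroup E] [InnerProductSpace ℝ E] (x y : E) :
    1 / 2 * ‖x‖ ^ 2 - 1 / 2 * ‖y‖ ^ 2 ≤ inner ℝ x (x - y) := by
  rw [inner_sub_right, real_inner_self_eq_norm_sq]
  nlinarith [real_inner_le_norm x y, sq_nonneg (‖x‖ - ‖y‖)]

theorem memLp_two_D3 (t : ℕ → ℝ) (u : ℕ → EnergySpace a b) (n : ℕ) :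
    MemLp (fun x => D3 t (fun k => (u k).val x) n) 2 (volume.restrict (box a b)) := by
  simp only [D3]
  exact memLp_finsetSum _ fun k _ =>
    ((u k).memLp_two_val.sub (u (k - 1)).memLp_two_val).const_mul _

theorem integrable_dissipation (t : ℕ → ℝ) (u : ℕ → EnergySpace a b) (n : ℕ) :
    Integrable (fun x => D3 t (fun k => (u k).val x) n * ((u n).val x - (u (n - 1)).val x))
      (volume.restrict (box a b)) :=
  (memLp_two_D3 t u n).integrable_mul ((u n).memLp_two_val.sub (u (n - 1)).memLp_two_val)

theorem integrable_val_sub_sq (u v : EnergySpace a b) :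
    Integrable (fun x => (u.val x - v.val x) ^ 2) (volume.restrict (box a b)) :=
  (u.memLp_two_val.sub v.memLp_two_val).integrable_sq

theorem energy_sub_add_le_zero {ε : ℝ} {t : ℕ → ℝ} {N : ℕ} {u : ℕ → EnergySpace a b}
    (hu : IsBDF3Solution ε t N u) {n : ℕ} (hn : 1 ≤ n) (hnN : n ≤ N) :
    energy ε (u n) - energy ε (u (n - 1))
      + ∫ x in box a b, (D3 t (fun k => (u k).val x) n * ((u n).val x - (u (n - 1)).val x)
        - 1 / 2 * ((u n).val x - (u (n - 1)).val x) ^ 2) ≤ 0 := by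
  -- The test function is the time increment `u^n - u^{n-1}`.
  have h := hu n hn hnN ((u n).sub (u (n - 1)))
  simp only [EnergySpace.sub] at h
  generalize hw : u (n - 1) = w at *
  have hsq := integrable_val_sub_sq (u n) w
  have hd := integrable_dissipation t u n
  rw [hw] at hd
  have hg : 1 / 2 * (∫ x in box a b, ‖(u n).grad x‖ ^ 2) - 1 / 2 * ∫ x in box a b, ‖w.grad x‖ ^ 2
      ≤ ∫ x in box a b, inner ℝ ((u n).grad x) ((u n).grad x - w.grad x) := by
    have i1 := (u n).integrable_norm_grad_sq.const_mul (1 / 2)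
    have i2 := w.integrable_norm_grad_sq.const_mul (1 / 2)
    rw [← integral_const_mul, ← integral_const_mul, ← integral_sub i1 i2]
    exact integral_mono (i1.sub i2) ((u n).integrable_inner_grad ((u n).sub w))
      fun x => norm_sq_sub_le_inner _ _
  have hp : 1 / 4 * (∫ x in box a b, ((u n).val x ^ 2 - 1) ^ 2)
      - 1 / 4 * (∫ x in box a b, (w.val x ^ 2 - 1) ^ 2)
      - 1 / 2 * (∫ x in box a b, ((u n).val x - w.val x) ^ 2)
      ≤ ∫ x in box a b, ((u n).val x ^ 3 - (u n).val x) * ((u n).val x - w.val x) := by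
    have i1 := (u n).integrable_potential.const_mul (1 / 4)
    have i2 := w.integrable_potential.const_mul (1 / 4)
    have i3 := hsq.const_mul (1 / 2)
    have i12 : Integrable (fun x => 1 / 4 * ((u n).val x ^ 2 - 1) ^ 2
        - 1 / 4 * (w.val x ^ 2 - 1) ^ 2) (volume.restrict (box a b)) := i1.sub i2
    rw [← integral_const_mul, ← integral_const_mul, ← integral_const_mul, ← integral_sub i1 i2,
      ← integral_sub i12 i3]
    exact integral_mono (i12.sub i3) ((u n).integrable_cubic_mul_sub w)
      fun x => double_well_sub_le _ _
  rw [integral_sub hd (hsq.const_mul _), integral_const_mul]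
  have hg' := mul_le_mul_of_nonneg_left hg (sq_nonneg ε)
  simp only [energy]
  linarith

theorem energy_le_initial_energy {ε : ℝ} {t : ℕ → ℝ} {N : ℕ} {u : ℕ → EnergySpace a b}
    (hu : IsBDF3Solution ε t N u) (ht : ∀ k, 1 ≤ k → k ≤ N → t (k - 1) < t k)
    (hr : ∀ n, 2 ≤ n → n ≤ N → stepRatio t n ≤ 1.405)
    (hτ : ∀ n, 1 ≤ n → n ≤ N → stepSize t n ≤ 2 * (1 / 200)) {n : ℕ} (hnN : n ≤ N) :
    energy ε (u n) ≤ energy ε (u 0) := by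
  have hsum : ∀ n, n ≤ N → energy ε (u n) - energy ε (u 0)
      + ∑ k ∈ Finset.Icc 1 n, ∫ x in box a b,
        (D3 t (fun k => (u k).val x) k * ((u k).val x - (u (k - 1)).val x)
          - 1 / 2 * ((u k).val x - (u (k - 1)).val x) ^ 2) ≤ 0 := by
    intro n
    induction n with
    | zero => simp
    | succ n ih =>
      intro hn
      have h := energy_sub_add_le_zero hu (Nat.le_add_left 1 n) hn
      rw [Finset.sum_Icc_succ_top (by omega)]
      simp only [Nat.add_sub_cancel] at h ⊢
      linarith [ih (by omega)]
  have h := hsum n hnN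
  have hint : ∀ k ∈ Finset.Icc 1 n, Integrable (fun x =>
      D3 t (fun k => (u k).val x) k * ((u k).val x - (u (k - 1)).val x)
        - 1 / 2 * ((u k).val x - (u (k - 1)).val x) ^ 2) (volume.restrict (box a b)) := fun k _ =>
    (integrable_dissipation t u k).sub ((integrable_val_sub_sq _ _).const_mul _)
  -- The sum goes inside the integral because the lower bound is for the accumulated dissipation at
  -- each `x`, not for each time step separately.
  rw [← integral_finsetSum _ hint] at h
  have h0 : 0 ≤ ∫ x in box a b, ∑ k ∈ Finset.Icc 1 n,
      (D3 t (fun k => (u k).val x) k * ((u k).val x - (u (k - 1)).val x)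
        - 1 / 2 * ((u k).val x - (u (k - 1)).val x) ^ 2) :=
    integral_nonneg fun x => sum_D3_mul_sub_nonneg ht hr hτ (fun k => (u k).val x) hnN
  linarith

end AllenCahnBDF3

theorem theorem4p2 {d : ℕ} (a b : Fin d → ℝ) (hab : ∀ i, a i < b i)
    (ε : ℝ) (hε : 0 < ε)
    (N : ℕ) (t : ℕ → ℝ) (ht0 : t 0 = 0) (ht : ∀ k, 1 ≤ k → k ≤ N → t (k - 1) < t k)
    (hr : ∀ n, 2 ≤ n → n ≤ N → AllenCahnBDF3.stepRatio t n ≤ 1.405)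
    (hτ : ∀ n, 1 ≤ n → n ≤ N →
      AllenCahnBDF3.stepSize t n ≤
        min (AllenCahnBDF3.solvabilityBound t n) (2 * (1 / 200)))
    (u : ℕ → AllenCahnBDF3.EnergySpace a b)
    (hu : AllenCahnBDF3.IsBDF3Solution ε t N u) :
    ∀ n, 1 ≤ n → n ≤ N → AllenCahnBDF3.energy ε (u n) ≤ AllenCahnBDF3.energy ε (u 0) := by
  intro n _ hnN
  exact AllenCahnBDF3.energy_le_initial_energy hu ht hr
    (fun k h1 h2 => (hτ k h1 h2).trans (min_le_right _ _)) hnN
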